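/- Let $(X,d)$ be a complete separable metric space and let $\mathsf E:X\to\mathbb R\cup\{+\infty\}$ be lower semicontinuous, with dense domain $D(\mathsf E)=\{\mathsf E<\infty\}$, and bounded from below on every $d$-bounded set. Assume that there is $\lambda\in\mathbb R$ such that every $x\in X$ is the starting point of an $\mathrm{EVI}_\lambda$-gradient flow of $\mathsf E$, i.e. there is a curve $(\gamma_t)_{t>0}$, locally absolutely continuous in $(0,\infty)$, with $\gamma_t\to x$ as $t\downarrow0$ and $$\tfrac12\tfrac{d}{dt}d^2(\gamma_t,z)+\tfrac\lambda2 d^2(\gamma_t,z)+\mathsf E(\gamma_t)\le \mathsf E(z)\qquad\forall z\in X,\ \text{a.e. }t>0.$$ Let $|\partial\mathsf E|(x)=\limsup_{z\to x}[\mathsf E(x)-\mathsf E(z)]^+/d(x,z)$ for $x\in D(\mathsf E)$ ($0$ if $x$ is isolated) and $|\partial \mathsf E|=+\infty$ outside $D(\mathsf E)$. Assume that $\sigma$ is a Hausdorff topology on $X$ such that every $d$-bounded sequence has a $\sigma$-converging subsequence and such that $d$ and $|\partial\mathsf E|$ are sequentially $\sigma$-lower semicontinuous. For $\gamma\in C([0,1],(X,d))$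 put $\mathcal A(\gamma)=\frac12\int_0^1|\dot\gamma_t|^2dt$ ($+\infty$ if $\gamma$ is not absolutely continuous; $|\dot\gamma_t|$ is the metric speed), $\mathcal I(\gamma)=\frac12\int_0^1|\partial\mathsf E|^2(\gamma_t)\,dt$, and $\mathcal A_\varepsilon=\mathcal A+\varepsilon^2\mathcal I$ for $\varepsilon\ge0$ (with $\mathcal A_0=\mathcal A$). Fix $x,y\in X$ and, for $\varepsilon\ge0$, let $C_\varepsilon(x,y)=\inf\{\mathcal A_\varepsilon(\gamma):\gamma\in C([0,1],X),\ \gamma_0=x,\ \gamma_1=y\}$ and let $\Lambda_\varepsilon(x,y)$ be the set of $\omega\in AC^2([0,1],X)$ (absolutely continuous curves with square integrable metric speed) with $\omega_0=x$, $\omega_1=y$ and $\mathcal A_\varepsilon(\omega)=C_\varepsilon(x,y)$. Assume that $\Lambda_\varepsilon(x,y)\neq\emptyset$ for some $\varepsilon>0$, and that there is $\omega^0\in\Lambda_0(x,y)$ with $\mathcal I(\omega^0)<\infty$. Then $C_\varepsilon(x,y)<\infty$ for all $\varepsilon\ge0$; the map $\varepsilon\mapsto C_\varepsilon(x,y)$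 is right differentiable at every $\varepsilon\ge0$, its right derivative vanishes at $\varepsilon=0$, and the right derivative is right continuous at every $\varepsilon\ge0$; moreover, as $\varepsilon\downarrow0$, $$C_\varepsilon(x,y)-C_0(x,y)=\varepsilon^2\inf_{\Lambda_0(x,y)}\mathcal I+o(\varepsilon^2).$$ Finally, let $\varepsilon_n>0$ with $\varepsilon_n\to0$ and $\omega^n\in\Lambda_{\varepsilon_n}(x,y)$. Then there is $\omega^*\in\Lambda_0(x,y)$ such that, up to a subsequence, $\omega^n_t\to\omega^*_t$ with respect to $\sigma$ for every $t\in[0,1]$, and $\mathcal I(\omega^*)=\min_{\Lambda_0(x,y)}\mathcal I$. Furthermore, every pointwise-in-time $\sigma$-limit of a subsequence of $(\omega^n)$ belongs to $\Lambda_0(x,y)$ and minimizes $\mathcal I$ over $\Lambda_0(x,y)$. -/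

import Mathlib

open Set Filter Topology MeasureTheory

open scoped ENNReal Asymptotics

noncomputable section

namespace MetricSchrodinger

variable {X : Type*} [MetricSpace X]

/-- The (descending) slope `|∂E|` of `E : X → ℝ ∪ {+∞}`, with values in `[0, ∞]`: it is `+∞` outside
the domain of `E`, and `limsup_{y → x, y ≠ x} [E x - E y]⁺ / d(x, y)` inside the domain.
`EReal.toENNReal` is the positive part. At an isolated point the filter `𝓝[≠] x` is trivial and
the `limsup` in `[0, ∞]` is `0`. -/
def descSlope (E : X → EReal) (x : X) : ℝ≥0∞ :=
  if E x = ⊤ then ⊤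
  else limsup (fun y => (E x - E y).toENNReal / edist x y) (𝓝[≠] x)

/-- Gradient flows of `E` in the `EVI_lam` sense: locally absolutely continuous curves on `(0, ∞)`
with `½ d/dt d²(γ_t, y) + (lam / 2) d²(γ_t, y) + E(γ_t) ≤ E(y)` for every `y` and a.e. `t > 0`.
(The function `t ↦ d²(γ_t, y)` is locally absolutely continuous, so its derivative exists a.e.) -/
structure IsEVIFlow (E : X → EReal) (lam : ℝ) (γ : ℝ → X) : Prop where
  locallyAC : ∀ a b : ℝ, 0 < a → a < b → AbsolutelyContinuousOnInterval γ a b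
  evi : ∀ y : X, ∀ᵐ t ∂(volume.restrict (Ioi (0 : ℝ))),
    ((1 / 2 * deriv (fun s => dist (γ s) y ^ 2) t + lam / 2 * dist (γ t) y ^ 2 : ℝ) : EReal)
      + E (γ t) ≤ E y

/-- The standing assumptions on the functional `E : X → ℝ ∪ {+∞}` (on a complete separable `X`). -/
structure IsEVIFunctional (E : X → EReal) : Prop where
  ne_bot : ∀ x, E x ≠ ⊥
  lsc : LowerSemicontinuous E
  dense_domain : Dense {x | E x < ⊤}
  bddBelow_of_bounded : ∀ B : Set X, Bornology.IsBounded B → ∃ c : ℝ, ∀ x ∈ B, (c : EReal) ≤ E x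
  exists_flow : ∃ lam : ℝ, ∀ x : X, ∃ γ : ℝ → X,
    IsEVIFlow E lam γ ∧ Tendsto γ (𝓝[>] 0) (𝓝 x)

/-- The auxiliary topology `σ` on `X`: it is Hausdorff, `d`-bounded sequences have `σ`-converging
subsequences, and both the distance (jointly) and the slope of `E` are sequentially `σ`-lower
semicontinuous. -/
structure IsAdmissibleTopology (E : X → EReal) (σ : TopologicalSpace X) : Prop where
  t2 : @T2Space X σ
  seqCompact : ∀ u : ℕ → X, Bornology.IsBounded (range u) →
    ∃ a : X, ∃ φ : ℕ → ℕ, StrictMono φ ∧ Tendsto (u ∘ φ) atTop (@nhds X σ a)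
  dist_lsc : ∀ (u v : ℕ → X) (a b : X),
    Tendsto u atTop (@nhds X σ a) → Tendsto v atTop (@nhds X σ b) →
      edist a b ≤ liminf (fun n => edist (u n) (v n)) atTop
  slope_lsc : ∀ (u : ℕ → X) (a : X), Tendsto u atTop (@nhds X σ a) →
    descSlope E a ≤ liminf (fun n => descSlope E (u n)) atTop

/-- Curves `γ ∈ C([0, 1], (X, d))` with `γ 0 = x` and `γ 1 = y`; continuity always refers to the
metric topology. -/
abbrev Curve (x y : X) : Type _ := Path x y

/-- The metric speed `lim_{s → t} d(c s, c t) / |s - t|`, written with a `limsup`; for an absolutely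
continuous curve the limit exists for a.e. `t`. -/
def metricSpeed (c : ℝ → X) (t : ℝ) : ℝ≥0∞ :=
  limsup (fun s => edist (c s) (c t) / edist s t) (𝓝[≠] t)

/-- `γ ∈ AC([0, 1], X)`. -/
def IsAC {x y : X} (γ : Curve x y) : Prop :=
  AbsolutelyContinuousOnInterval γ.extend 0 1

/-- `γ ∈ AC²([0, 1], X)`: absolutely continuous with square integrable metric speed. -/
def IsAC2 {x y : X} (γ : Curve x y) : Prop :=
  IsAC γ ∧ ∫⁻ t in Icc (0 : ℝ) 1, metricSpeed γ.extend t ^ 2 < ⊤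

open Classical in
/-- The kinetic energy `𝒜(γ) = ½ ∫₀¹ |γ'_t|² dt`, equal to `+∞` if `γ` is not absolutely
continuous. -/
def kinetic {x y : X} (γ : Curve x y) : ℝ≥0∞ :=
  if IsAC γ then 2⁻¹ * ∫⁻ t in Icc (0 : ℝ) 1, metricSpeed γ.extend t ^ 2 else ⊤

/-- The (halved) Fisher information `ℐ(γ) = ½ ∫₀¹ |∂E|²(γ_t) dt`. -/
def fisher (E : X → EReal) {x y : X} (γ : Curve x y) : ℝ≥0∞ :=
  2⁻¹ * ∫⁻ t in Icc (0 : ℝ) 1, descSlope E (γ.extend t) ^ 2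

/-- `𝒜_ε(γ) = 𝒜(γ) + ε² ℐ(γ)`, with `0 * ∞ = 0`, so that `𝒜_0 = 𝒜`. -/
def action (E : X → EReal) (ε : ℝ) {x y : X} (γ : Curve x y) : ℝ≥0∞ :=
  kinetic γ + ENNReal.ofReal (ε ^ 2) * fisher E γ

/-- The optimal entropic cost `C_ε(x, y)`. -/
def cost (E : X → EReal) (x y : X) (ε : ℝ) : ℝ≥0∞ :=
  ⨅ γ : Curve x y, action E ε γ

/-- The set `Λ_ε(x, y)` of `ε`-minimizers. -/
def minimizers (E : X → EReal) (x y : X) (ε : ℝ) : Set (Curve x y) :=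
  {ω | IsAC2 ω ∧ action E ε ω = cost E x y ε}

/-- `ω` belongs to `Λ_0(x, y)` and has the least Fisher information there. -/
def IsFisherMinimalGeodesic (E : X → EReal) {x y : X} (ω : Curve x y) : Prop :=
  ω ∈ minimizers E x y 0 ∧ ∀ ω' ∈ minimizers E x y 0, fisher E ω ≤ fisher E ω'

/-- Convergence of a sequence of curves in the pointwise-in-time `σ`-topology. -/
def TendstoPointwise (σ : TopologicalSpace X) (u : ℕ → unitInterval → X)
    (v : unitInterval → X) : Prop :=
  ∀ t : unitInterval, Tendsto (fun n => u n t) atTop (@nhds X σ (v t))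

end MetricSchrodinger

end

noncomputable section

namespace MetricSchrodinger

variable {X : Type*} [MetricSpace X]

/-! ### Metric speed of absolutely continuous curves -/

/-- Cauchy–Schwarz against the constant function `1`. -/
theorem sq_lintegral_le {α : Type*} [MeasurableSpace α] (μ : Measure α) {g : α → ℝ≥0∞}
    (hg : AEMeasurable g μ) : (∫⁻ a, g a ∂μ) ^ 2 ≤ μ univ * ∫⁻ a, g a ^ 2 ∂μ := by
  have h := ENNReal.lintegral_mul_le_Lp_mul_Lq μ Real.HolderConjugate.two_two
    (aemeasurable_const (b := (1 : ℝ≥0∞))) hg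
  simp only [Pi.mul_apply, one_mul, ENNReal.one_rpow, lintegral_const] at h
  have h2 := pow_le_pow_left₀ zero_le h 2
  refine h2.trans_eq ?_
  rw [mul_pow, ← ENNReal.rpow_natCast, ← ENNReal.rpow_natCast, ← ENNReal.rpow_mul,
    ← ENNReal.rpow_mul]
  norm_num

/-- The lower forward speed of a curve along the steps `1 / (n + 1)`. -/
def forwardSpeed (f : ℝ → X) (t : ℝ) : ℝ≥0∞ :=
  liminf (fun n : ℕ => edist (f (t + ((n : ℝ) + 1)⁻¹)) (f t) / ENNReal.ofReal ((n : ℝ) + 1)⁻¹) atTop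

theorem measurable_forwardSpeed {f : ℝ → X} (hf : Continuous f) :
    Measurable (forwardSpeed f) := by
  refine Measurable.liminf fun n => ?_
  have : Continuous fun t => edist (f (t + ((n : ℝ) + 1)⁻¹)) (f t) := by fun_prop
  exact this.measurable.div_const _

theorem tendsto_add_inv_succ_nhdsNE (t : ℝ) :
    Tendsto (fun n : ℕ => t + ((n : ℝ) + 1)⁻¹) atTop (𝓝[≠] t) := by
  refine tendsto_nhdsWithin_iff.2 ⟨?_, Eventually.of_forall fun n => ?_⟩
  · simpa [one_div] using (tendsto_one_div_add_atTop_nhds_zero_nat (𝕜 := ℝ)).const_add t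
  · have : (0 : ℝ) < ((n : ℝ) + 1)⁻¹ := by positivity
    simp [this.ne']

theorem forwardSpeed_le_metricSpeed (f : ℝ → X) (t : ℝ) :
    forwardSpeed f t ≤ metricSpeed f t := by
  refine (liminf_le_limsup).trans ?_
  have h := limsup_le_limsup_of_le (u := fun s => edist (f s) (f t) / edist s t)
    (tendsto_add_inv_succ_nhdsNE t)
  refine le_trans (le_of_eq ?_) h
  rw [limsup, limsup, Filter.map_map]
  congr 2
  funext n
  have : (0 : ℝ) < ((n : ℝ) + 1)⁻¹ := by positivity
  simp [edist_dist, Real.dist_eq, abs_of_pos this]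

theorem enorm_deriv_dist_le_forwardSpeed {f : ℝ → X} {p : X} {t : ℝ}
    (h : DifferentiableAt ℝ (fun s => dist (f s) p) t) :
    ‖deriv (fun s => dist (f s) p) t‖ₑ ≤ forwardSpeed f t := by
  have h1 := (h.hasDerivAt.tendsto_slope.comp (tendsto_add_inv_succ_nhdsNE t)).enorm
  rw [← h1.liminf_eq]
  refine liminf_le_liminf (Eventually.of_forall fun n => ?_)
  have hn : (0 : ℝ) < ((n : ℝ) + 1)⁻¹ := by positivity
  simp only [Function.comp_apply, slope_def_module, add_sub_cancel_left, smul_eq_mul]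
  rw [enorm_mul, ENNReal.div_eq_inv_mul, ← ofReal_norm (_⁻¹ : ℝ), norm_inv,
    Real.norm_of_nonneg hn.le, ENNReal.ofReal_inv_of_pos hn]
  gcongr
  rw [← edist_eq_enorm_sub, edist_dist, edist_dist]
  exact ENNReal.ofReal_le_ofReal (abs_dist_sub_le _ _ _)

theorem _root_.AbsolutelyContinuousOnInterval.dist_const {f : ℝ → X} {a b : ℝ}
    (hf : AbsolutelyContinuousOnInterval f a b) (p : X) :
    AbsolutelyContinuousOnInterval (fun s => dist (f s) p) a b := by
  refine squeeze_zero (fun E => Finset.sum_nonneg fun i _ => dist_nonneg) (fun E => ?_) hf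
  exact Finset.sum_le_sum fun i _ => abs_dist_sub_le _ _ _

theorem edist_le_lintegral_forwardSpeed {f : ℝ → X} {a b : ℝ} (hab : a ≤ b)
    (hf : AbsolutelyContinuousOnInterval f a b) :
    edist (f a) (f b) ≤ ∫⁻ r in Icc a b, forwardSpeed f r := by
  have hφ := hf.dist_const (f a)
  have h1 := hφ.integral_deriv_eq_sub
  rw [dist_self, sub_zero, intervalIntegral.integral_of_le hab] at h1
  have h2 := enorm_integral_le_lintegral_enorm (μ := volume.restrict (Ioc a b))
    (deriv fun s => dist (f s) (f a))
  rw [h1] at h2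
  have h3 : edist (f a) (f b) = ‖dist (f b) (f a)‖ₑ := by
    rw [edist_comm, edist_dist, ← ofReal_norm, Real.norm_of_nonneg dist_nonneg]
  rw [h3, ← restrict_Ioc_eq_restrict_Icc]
  refine h2.trans (lintegral_mono_ae ?_)
  filter_upwards [ae_restrict_of_ae hφ.ae_differentiableAt, ae_restrict_mem measurableSet_Ioc]
    with r hr hm
  refine enorm_deriv_dist_le_forwardSpeed (hr ?_)
  rw [uIcc_of_le hab]
  exact Ioc_subset_Icc_self hm

theorem measurable_metricSpeed {f : ℝ → X} (hf : Continuous f) :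
    Measurable (metricSpeed f) := by
  have key : metricSpeed f = fun t => ⨅ n : ℕ, ⨆ h : ℝ, ⨆ _ : h ≠ 0 ∧ |h| < ((n : ℝ) + 1)⁻¹,
      edist (f (t + h)) (f t) / ENNReal.ofReal |h| := by
    funext t
    have hb : (𝓝[≠] t).HasBasis (fun _ : ℕ => True)
        (fun n => {s | s ≠ t ∧ |s - t| < ((n : ℝ) + 1)⁻¹}) := by
      have h1 := (nhdsWithin_hasBasis (Metric.nhds_basis_ball_inv_nat_succ (x := t)) {t}ᶜ)
      refine h1.congr (fun _ => Iff.rfl) fun n _ => ?_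
      ext s
      simp [Real.dist_eq, and_comm]
    rw [metricSpeed, hb.limsup_eq_iInf_iSup]
    simp only [iInf_true]
    refine iInf_congr fun n => le_antisymm ?_ ?_
    · refine iSup₂_le fun s hs => ?_
      refine le_iSup₂_of_le (s - t) ⟨sub_ne_zero.2 hs.1, hs.2⟩ ?_
      rw [add_sub_cancel, edist_dist s t, Real.dist_eq]
    · refine iSup₂_le fun h hh => ?_
      refine le_iSup₂_of_le (t + h) ⟨by simpa using hh.1, by simpa using hh.2⟩ ?_
      rw [edist_dist (t + h) t, Real.dist_eq, add_sub_cancel_left]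
  rw [key]
  refine Measurable.iInf fun n => LowerSemicontinuous.measurable ?_
  refine lowerSemicontinuous_biSup fun h hh => Continuous.lowerSemicontinuous ?_
  refine ENNReal.continuous_div_const _ ?_ |>.comp (by fun_prop)
  simpa using hh.1

theorem edist_le_lintegral_metricSpeed {f : ℝ → X} {a b : ℝ} (hab : a ≤ b)
    (hf : AbsolutelyContinuousOnInterval f a b) :
    edist (f a) (f b) ≤ ∫⁻ r in Icc a b, metricSpeed f r :=
  (edist_le_lintegral_forwardSpeed hab hf).trans
    (lintegral_mono fun _ => forwardSpeed_le_metricSpeed f _)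

/-- Almost everywhere, the metric speed of an absolutely continuous curve with integrable forward
speed does not exceed its lower forward speed. -/
theorem ae_metricSpeed_le_forwardSpeed {f : ℝ → X} {a b : ℝ} (hc : Continuous f)
    (hf : AbsolutelyContinuousOnInterval f a b)
    (hfin : ∫⁻ r in Icc a b, forwardSpeed f r ≠ ⊤) :
    ∀ᵐ t, t ∈ Ioo a b → metricSpeed f t ≤ forwardSpeed f t := by
  set w : ℝ → ℝ≥0∞ := (Icc a b).indicator (forwardSpeed f) with hw
  have hwm : Measurable w := (measurable_forwardSpeed hc).indicator measurableSet_Icc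
  have hwfin : ∫⁻ r, w r ≠ ⊤ := by rwa [hw, lintegral_indicator measurableSet_Icc]
  have hint : ∀ s t, a ≤ s → s ≤ t → t ≤ b → edist (f s) (f t) ≤ ∫⁻ r in Icc s t, w r := by
    intro s t has hst htb
    have hsub : Icc s t ⊆ Icc a b := Icc_subset_Icc has htb
    have hac : AbsolutelyContinuousOnInterval f s t := hf.mono (by
      rwa [uIcc_of_le hst, uIcc_of_le (has.trans (hst.trans htb))])
    refine (edist_le_lintegral_forwardSpeed hst hac).trans_eq ?_
    refine setLIntegral_congr_fun measurableSet_Icc fun r hr => ?_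
    rw [hw, indicator_of_mem (hsub hr)]
  filter_upwards [(IsUnifLocDoublingMeasure.vitaliFamily (volume : Measure ℝ)
    1).ae_tendsto_lintegral_div hwm.aemeasurable hwfin] with t ht hmem
  have hwt : w t = forwardSpeed f t := by
    rw [hw, indicator_of_mem (Ioo_subset_Icc_self hmem)]
  rw [← hwt, metricSpeed]
  have hR := ht.comp (Real.tendsto_Icc_vitaliFamily_right t)
  have hL := ht.comp (Real.tendsto_Icc_vitaliFamily_left t)
  rw [← Iio_union_Ioi, nhdsWithin_union, limsup_sup_filter]
  refine sup_le ?_ ?_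
  · rw [← hL.limsup_eq]
    refine limsup_le_limsup ?_
    filter_upwards [self_mem_nhdsWithin, Ioo_mem_nhdsLT hmem.1] with s hs hs'
    simp only [Function.comp_apply, Real.volume_Icc]
    rw [edist_dist s t, dist_comm s t, Real.dist_eq, abs_of_pos (sub_pos.2 hs)]
    gcongr
    exact hint s t hs'.1.le hs'.2.le hmem.2.le
  · rw [← hR.limsup_eq]
    refine limsup_le_limsup ?_
    filter_upwards [self_mem_nhdsWithin, Ioo_mem_nhdsGT hmem.2] with s hs hs'
    simp only [Function.comp_apply, Real.volume_Icc]
    rw [edist_dist s t, Real.dist_eq, abs_of_pos (sub_pos.2 hs), edist_comm]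
    gcongr
    exact hint t s hmem.1.le hs'.1.le hs'.2.le


/-! ### Estimates by the kinetic energy -/

theorem kinetic_of_isAC {x y : X} {γ : Curve x y} (h : IsAC γ) :
    kinetic γ = 2⁻¹ * ∫⁻ t in Icc (0 : ℝ) 1, metricSpeed γ.extend t ^ 2 := by
  rw [kinetic, if_pos h]

theorem isAC_of_kinetic_ne_top {x y : X} {γ : Curve x y} (h : kinetic γ ≠ ⊤) : IsAC γ := by
  by_contra hc
  exact h (by rw [kinetic, if_neg hc])

theorem lintegral_metricSpeed_sq {x y : X} {γ : Curve x y} (h : IsAC γ) :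
    ∫⁻ t in Icc (0 : ℝ) 1, metricSpeed γ.extend t ^ 2 = 2 * kinetic γ := by
  rw [kinetic_of_isAC h, ← mul_assoc, ENNReal.mul_inv_cancel (by simp) (by simp), one_mul]

theorem isAC2_iff_kinetic_ne_top {x y : X} {γ : Curve x y} : IsAC2 γ ↔ kinetic γ ≠ ⊤ := by
  constructor
  · rintro ⟨h1, h2⟩
    rw [kinetic_of_isAC h1]
    exact ENNReal.mul_ne_top (by simp) h2.ne
  · intro h
    have h1 := isAC_of_kinetic_ne_top h
    refine ⟨h1, ?_⟩
    rw [lintegral_metricSpeed_sq h1]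
    exact (ENNReal.mul_ne_top (by simp) h).lt_top

/-- The metric speed of a curve, extended by zero outside of the unit interval. -/
def unitSpeed {x y : X} (γ : Curve x y) : ℝ → ℝ≥0∞ :=
  (Icc (0 : ℝ) 1).indicator (metricSpeed γ.extend)

theorem measurable_unitSpeed {x y : X} (γ : Curve x y) : Measurable (unitSpeed γ) :=
  (measurable_metricSpeed γ.continuous_extend).indicator measurableSet_Icc

theorem lintegral_unitSpeed_sq {x y : X} {γ : Curve x y} (h : IsAC γ) :
    ∫⁻ t, unitSpeed γ t ^ 2 = 2 * kinetic γ := by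
  rw [← lintegral_metricSpeed_sq h, ← lintegral_indicator measurableSet_Icc]
  refine lintegral_congr fun t => ?_
  by_cases ht : t ∈ Icc (0 : ℝ) 1 <;> simp [unitSpeed, ht]

theorem edist_extend_le_lintegral {x y : X} {γ : Curve x y} (h : IsAC γ) {s t : ℝ} (hst : s ≤ t) :
    edist (γ.extend s) (γ.extend t) ≤ ∫⁻ r in Icc s t, unitSpeed γ r := by
  rcases le_total t 0 with ht | ht
  · rw [γ.extend_of_le_zero ht, γ.extend_of_le_zero (hst.trans ht), edist_self]
    exact zero_le
  rcases le_total 1 s with hs | hs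
  · rw [γ.extend_of_one_le hs, γ.extend_of_one_le (hs.trans hst), edist_self]
    exact zero_le
  have hs' : γ.extend s = γ.extend (max s 0) := by
    rcases le_total s 0 with h0 | h0
    · rw [max_eq_right h0, γ.extend_of_le_zero h0, γ.extend_of_le_zero le_rfl]
    · rw [max_eq_left h0]
  have ht' : γ.extend t = γ.extend (min t 1) := by
    rcases le_total t 1 with h0 | h0
    · rw [min_eq_left h0]
    · rw [min_eq_right h0, γ.extend_of_one_le h0, γ.extend_of_one_le le_rfl]
  have hle : max s 0 ≤ min t 1 := max_le (le_min hst hs) (le_min ht zero_le_one)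
  have hsub : Icc (max s 0) (min t 1) ⊆ Icc 0 1 :=
    Icc_subset_Icc (le_max_right _ _) (min_le_right _ _)
  have hac : AbsolutelyContinuousOnInterval γ.extend (max s 0) (min t 1) :=
    AbsolutelyContinuousOnInterval.mono h
      (by rwa [uIcc_of_le hle, uIcc_of_le zero_le_one])
  rw [hs', ht']
  calc edist (γ.extend (max s 0)) (γ.extend (min t 1))
      ≤ ∫⁻ r in Icc (max s 0) (min t 1), metricSpeed γ.extend r :=
        edist_le_lintegral_metricSpeed hle hac
    _ = ∫⁻ r in Icc (max s 0) (min t 1), unitSpeed γ r :=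
        setLIntegral_congr_fun measurableSet_Icc fun r hr => by
          rw [unitSpeed, indicator_of_mem (hsub hr)]
    _ ≤ ∫⁻ r in Icc s t, unitSpeed γ r :=
        lintegral_mono_set (Icc_subset_Icc (le_max_left _ _) (min_le_left _ _))

theorem edist_extend_sq_le {x y : X} {γ : Curve x y} (h : IsAC γ) {s t : ℝ} (hst : s ≤ t) :
    edist (γ.extend s) (γ.extend t) ^ 2
      ≤ ENNReal.ofReal (t - s) * ∫⁻ r in Icc s t, unitSpeed γ r ^ 2 := by
  refine (pow_le_pow_left₀ zero_le (edist_extend_le_lintegral h hst) 2).trans ?_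
  simpa using sq_lintegral_le (volume.restrict (Icc s t)) (measurable_unitSpeed γ).aemeasurable

/-- Curves of finite kinetic energy are `1/2`-Hölder continuous. -/
theorem edist_sq_le_kinetic {x y : X} {γ : Curve x y} (h : IsAC γ) (s t : unitInterval) :
    edist (γ s) (γ t) ^ 2 ≤ edist s t * (2 * kinetic γ) := by
  wlog hst : s ≤ t generalizing s t
  · rw [edist_comm, edist_comm s]
    exact this t s (le_of_not_ge hst)
  have h1 := edist_extend_sq_le h (show (s : ℝ) ≤ t from hst)
  rw [γ.extend_apply s.2, γ.extend_apply t.2] at h1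
  refine h1.trans ?_
  rw [edist_comm s t, edist_dist t s, Subtype.dist_eq, Real.dist_eq,
    abs_of_nonneg (sub_nonneg.2 (show (s : ℝ) ≤ t from hst)), ← lintegral_unitSpeed_sq h]
  gcongr
  exact Measure.restrict_le_self

/-- The squared difference quotients of a curve are controlled by its kinetic energy. -/
theorem lintegral_differenceQuotient_sq_le {x y : X} {γ : Curve x y} (hγ : IsAC γ) {h : ℝ}
    (hh : 0 < h) :
    ∫⁻ t, (edist (γ.extend (t + h)) (γ.extend t) / ENNReal.ofReal h) ^ 2 ≤ 2 * kinetic γ := by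
  have hm : Measurable fun r => unitSpeed γ r ^ 2 := (measurable_unitSpeed γ).pow_const 2
  have h0 : ENNReal.ofReal h ≠ 0 := by simpa using hh
  have hpt : ∀ t, (edist (γ.extend (t + h)) (γ.extend t) / ENNReal.ofReal h) ^ 2
      ≤ (ENNReal.ofReal h)⁻¹ * ∫⁻ r in Icc 0 h, unitSpeed γ (t + r) ^ 2 := by
    intro t
    have h1 := edist_extend_sq_le hγ (show t ≤ t + h by linarith)
    have h2 : ∫⁻ r in Icc t (t + h), unitSpeed γ r ^ 2
        = ∫⁻ r in Icc 0 h, unitSpeed γ (t + r) ^ 2 := by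
      rw [← lintegral_indicator measurableSet_Icc, ← lintegral_indicator measurableSet_Icc,
        ← lintegral_add_left_eq_self _ t]
      refine lintegral_congr fun r => ?_
      have hr : (t + r ∈ Icc t (t + h)) ↔ r ∈ Icc 0 h := by simp
      by_cases h : r ∈ Icc 0 h
      · rw [indicator_of_mem h, indicator_of_mem (hr.2 h)]
      · rw [indicator_of_notMem h, indicator_of_notMem (fun h' => h (hr.1 h'))]
    rw [h2, add_sub_cancel_left, edist_comm] at h1
    rw [ENNReal.div_eq_inv_mul, mul_pow]
    calc (ENNReal.ofReal h)⁻¹ ^ 2 * edist (γ.extend (t + h)) (γ.extend t) ^ 2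
        ≤ (ENNReal.ofReal h)⁻¹ ^ 2
          * (ENNReal.ofReal h * ∫⁻ r in Icc 0 h, unitSpeed γ (t + r) ^ 2) := by gcongr
      _ = (ENNReal.ofReal h)⁻¹ * ((ENNReal.ofReal h)⁻¹ * ENNReal.ofReal h)
          * ∫⁻ r in Icc 0 h, unitSpeed γ (t + r) ^ 2 := by ring
      _ = _ := by rw [ENNReal.inv_mul_cancel h0 ENNReal.ofReal_ne_top, mul_one]
  calc ∫⁻ t, (edist (γ.extend (t + h)) (γ.extend t) / ENNReal.ofReal h) ^ 2
      ≤ ∫⁻ t, (ENNReal.ofReal h)⁻¹ * ∫⁻ r in Icc 0 h, unitSpeed γ (t + r) ^ 2 :=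
        lintegral_mono hpt
    _ = (ENNReal.ofReal h)⁻¹ * ∫⁻ t, ∫⁻ r in Icc 0 h, unitSpeed γ (t + r) ^ 2 := by
        rw [lintegral_const_mul' _ _ (by simpa using hh)]
    _ = (ENNReal.ofReal h)⁻¹ * ∫⁻ r in Icc 0 h, ∫⁻ t, unitSpeed γ (t + r) ^ 2 := by
        rw [lintegral_lintegral_swap]
        exact (hm.comp (measurable_fst.add measurable_snd)).aemeasurable
    _ = (ENNReal.ofReal h)⁻¹ * ∫⁻ _ in Icc 0 h, 2 * kinetic γ := by
        congr 1
        refine lintegral_congr fun r => ?_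
        rw [← lintegral_unitSpeed_sq hγ, lintegral_add_right_eq_self (fun t => unitSpeed γ t ^ 2)]
    _ = 2 * kinetic γ := by
        rw [lintegral_const, Measure.restrict_apply_univ, Real.volume_Icc, sub_zero, mul_comm,
          mul_assoc, ENNReal.mul_inv_cancel h0 ENNReal.ofReal_ne_top, mul_one]

open AbsolutelyContinuousOnInterval in
/-- The variation of a curve along disjoint intervals is controlled by their total length and the
kinetic energy. -/
theorem sum_edist_sq_le {x y : X} {γ : Curve x y} (hγ : IsAC γ) {I : ℕ × (ℕ → ℝ × ℝ)}
    (hI : I ∈ disjWithin 0 1) :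
    (∑ i ∈ Finset.range I.1, edist (γ.extend (I.2 i).1) (γ.extend (I.2 i).2)) ^ 2
      ≤ ENNReal.ofReal (∑ i ∈ Finset.range I.1, dist (I.2 i).1 (I.2 i).2) * (2 * kinetic γ) := by
  set U := ⋃ i ∈ Finset.range I.1, uIoc (I.2 i).1 (I.2 i).2 with hU
  have h1 : ∀ a b : ℝ, edist (γ.extend a) (γ.extend b) ≤ ∫⁻ r in uIoc a b, unitSpeed γ r := by
    intro a b
    rcases le_total a b with hab | hab
    · rw [uIoc_of_le hab, restrict_Ioc_eq_restrict_Icc]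
      exact edist_extend_le_lintegral hγ hab
    · rw [uIoc_of_ge hab, restrict_Ioc_eq_restrict_Icc, edist_comm]
      exact edist_extend_le_lintegral hγ hab
  have h2 : ∑ i ∈ Finset.range I.1, edist (γ.extend (I.2 i).1) (γ.extend (I.2 i).2)
      ≤ ∫⁻ r in U, unitSpeed γ r := by
    rw [hU, lintegral_biUnion_finset hI.2 fun _ _ => measurableSet_uIoc]
    exact Finset.sum_le_sum fun i _ => h1 _ _
  have h3 : volume U ≤ ENNReal.ofReal (∑ i ∈ Finset.range I.1, dist (I.2 i).1 (I.2 i).2) := by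
    rw [hU, ENNReal.ofReal_sum_of_nonneg fun _ _ => dist_nonneg]
    refine (measure_biUnion_finset_le _ _).trans (Finset.sum_le_sum fun i _ => le_of_eq ?_)
    simp [uIoc, Real.dist_eq, max_sub_min_eq_abs']
  refine (pow_le_pow_left₀ zero_le h2 2).trans ((sq_lintegral_le _
    (measurable_unitSpeed γ).aemeasurable).trans ?_)
  rw [Measure.restrict_apply_univ, ← lintegral_unitSpeed_sq hγ]
  gcongr
  exact Measure.restrict_le_self

/-! ### Lower semicontinuity of the kinetic energy -/

theorem liminf_add_liminf_le (u v : ℕ → ℝ≥0∞) :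
    liminf u atTop + liminf v atTop ≤ liminf (fun n => u n + v n) atTop := by
  simp only [liminf_eq_iSup_iInf_of_nat]
  rw [ENNReal.iSup_add_iSup_of_monotone]
  · exact iSup_mono fun n => le_iInf₂ fun i hi => add_le_add (iInf₂_le i hi) (iInf₂_le i hi)
  · exact fun m n hmn => le_iInf₂ fun i hi => iInf₂_le i (hmn.trans hi)
  · exact fun m n hmn => le_iInf₂ fun i hi => iInf₂_le i (hmn.trans hi)

theorem sum_liminf_le {ι : Type*} (S : Finset ι) (u : ι → ℕ → ℝ≥0∞) :
    ∑ i ∈ S, liminf (u i) atTop ≤ liminf (fun n => ∑ i ∈ S, u i n) atTop := by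
  classical
  induction S using Finset.induction_on with
  | empty => simp
  | insert a S ha ih =>
    simp only [Finset.sum_insert ha]
    exact (add_le_add le_rfl ih).trans (liminf_add_liminf_le _ _)

/-- A curve is absolutely continuous as soon as its mutual distances are bounded by the lower limits
of those of curves of bounded kinetic energy. -/
theorem isAC_of_edist_le_liminf {x y : X} {γ : ℕ → Curve x y} {ω : Curve x y} {K : ℝ≥0∞}
    (hK : K ≠ ⊤) (hγ : ∀ n, kinetic (γ n) ≤ K)
    (hω : ∀ s t, edist (ω s) (ω t) ≤ liminf (fun n => edist (γ n s) (γ n t)) atTop) :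
    IsAC ω := by
  have hac : ∀ n, IsAC (γ n) := fun n => isAC_of_kinetic_ne_top ((hγ n).trans_lt hK.lt_top).ne
  have hsum : ∀ I ∈ AbsolutelyContinuousOnInterval.disjWithin 0 1,
      (∑ i ∈ Finset.range I.1, edist (ω.extend (I.2 i).1) (ω.extend (I.2 i).2)) ^ 2
        ≤ ENNReal.ofReal (∑ i ∈ Finset.range I.1, dist (I.2 i).1 (I.2 i).2) * (2 * K) := by
    intro I hI
    have h1 : ∑ i ∈ Finset.range I.1, edist (ω.extend (I.2 i).1) (ω.extend (I.2 i).2)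
        ≤ liminf (fun n => ∑ i ∈ Finset.range I.1,
          edist ((γ n).extend (I.2 i).1) ((γ n).extend (I.2 i).2)) atTop :=
      (Finset.sum_le_sum fun i _ => hω _ _).trans (sum_liminf_le _ _)
    have h2 : ∀ n, ∑ i ∈ Finset.range I.1, edist ((γ n).extend (I.2 i).1) ((γ n).extend (I.2 i).2)
        ≤ (ENNReal.ofReal (∑ i ∈ Finset.range I.1, dist (I.2 i).1 (I.2 i).2) * (2 * K))
          ^ (2⁻¹ : ℝ) := by
      intro n
      rw [ENNReal.le_rpow_inv_iff (by norm_num), show (2 : ℝ) = ((2 : ℕ) : ℝ) by norm_num,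
        ENNReal.rpow_natCast]
      refine (sum_edist_sq_le (hac n) hI).trans ?_
      gcongr
      exact hγ n
    have h3 := h1.trans (liminf_le_of_frequently_le' (Frequently.of_forall h2))
    rwa [ENNReal.le_rpow_inv_iff (by norm_num), show (2 : ℝ) = ((2 : ℕ) : ℝ) by norm_num,
        ENNReal.rpow_natCast] at h3
  rw [IsAC, absolutelyContinuousOnInterval_iff]
  intro e he
  refine ⟨e ^ 2 / (2 * K.toReal + 1), by positivity, fun I hI hlt => ?_⟩
  have h := hsum I hI
  have hD : ∑ i ∈ Finset.range I.1, edist (ω.extend (I.2 i).1) (ω.extend (I.2 i).2)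
      = ENNReal.ofReal (∑ i ∈ Finset.range I.1, dist (ω.extend (I.2 i).1) (ω.extend (I.2 i).2)) := by
    rw [ENNReal.ofReal_sum_of_nonneg fun _ _ => dist_nonneg]
    exact Finset.sum_congr rfl fun _ _ => edist_dist _ _
  have hd0 : 0 ≤ ∑ i ∈ Finset.range I.1, dist (ω.extend (I.2 i).1) (ω.extend (I.2 i).2) :=
    Finset.sum_nonneg fun _ _ => dist_nonneg
  have hl0 : 0 ≤ ∑ i ∈ Finset.range I.1, dist (I.2 i).1 (I.2 i).2 :=
    Finset.sum_nonneg fun _ _ => dist_nonneg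
  have hKr : ENNReal.ofReal (2 * K.toReal) = 2 * K := by
    rw [ENNReal.ofReal_mul (by norm_num), ENNReal.ofReal_toReal hK, ENNReal.ofReal_ofNat]
  rw [hD, ← hKr, ← ENNReal.ofReal_pow hd0, ← ENNReal.ofReal_mul hl0,
    ENNReal.ofReal_le_ofReal_iff (by positivity)] at h
  refine lt_of_pow_lt_pow_left₀ 2 he.le (h.trans_lt ?_)
  rw [lt_div_iff₀ (by positivity)] at hlt
  nlinarith

/-- Lower semicontinuity of the kinetic energy. -/
theorem kinetic_le_of_edist_le_liminf {x y : X} {γ : ℕ → Curve x y} {ω : Curve x y} {K : ℝ≥0∞}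
    (hK : K ≠ ⊤) (hγ : ∀ n, kinetic (γ n) ≤ K)
    (hω : ∀ s t, edist (ω s) (ω t) ≤ liminf (fun n => edist (γ n s) (γ n t)) atTop) :
    kinetic ω ≤ K := by
  have hωac := isAC_of_edist_le_liminf hK hγ hω
  have hac : ∀ n, IsAC (γ n) := fun n => isAC_of_kinetic_ne_top ((hγ n).trans_lt hK.lt_top).ne
  have hquot : ∀ h : ℝ, 0 < h →
      ∫⁻ t, (edist (ω.extend (t + h)) (ω.extend t) / ENNReal.ofReal h) ^ 2 ≤ 2 * K := by
    intro h hh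
    have hc : ∀ n, Measurable fun t =>
        (edist ((γ n).extend (t + h)) ((γ n).extend t) / ENNReal.ofReal h) ^ 2 := fun n => by
      have := (γ n).continuous_extend
      have h2 : Continuous fun t => edist ((γ n).extend (t + h)) ((γ n).extend t) := by fun_prop
      exact (h2.measurable.div_const _).pow_const 2
    calc ∫⁻ t, (edist (ω.extend (t + h)) (ω.extend t) / ENNReal.ofReal h) ^ 2
        ≤ ∫⁻ t, liminf (fun n =>
          (edist ((γ n).extend (t + h)) ((γ n).extend t) / ENNReal.ofReal h) ^ 2) atTop := by
          refine lintegral_mono fun t => ?_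
          have hmono : Monotone fun z : ℝ≥0∞ => (z / ENNReal.ofReal h) ^ 2 := fun a b hab => by
            dsimp only
            gcongr
          have hcont : Continuous fun z : ℝ≥0∞ => (z / ENNReal.ofReal h) ^ 2 :=
            (ENNReal.continuous_pow 2).comp (ENNReal.continuous_div_const _ (by simpa using hh))
          refine (hmono (hω _ _)).trans_eq ?_
          exact hmono.map_liminf_of_continuousAt _ hcont.continuousAt
      _ ≤ liminf (fun n => ∫⁻ t,
          (edist ((γ n).extend (t + h)) ((γ n).extend t) / ENNReal.ofReal h) ^ 2) atTop :=
          lintegral_liminf_le hc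
      _ ≤ 2 * K := by
          refine liminf_le_of_frequently_le' (Frequently.of_forall fun n => ?_)
          refine (lintegral_differenceQuotient_sq_le (hac n) hh).trans ?_
          gcongr
          exact hγ n
  have hcω := ω.continuous_extend
  have hfwd : ∫⁻ t, forwardSpeed ω.extend t ^ 2 ≤ 2 * K := by
    calc ∫⁻ t, forwardSpeed ω.extend t ^ 2
        = ∫⁻ t, liminf (fun n : ℕ => (edist (ω.extend (t + ((n : ℝ) + 1)⁻¹)) (ω.extend t)
            / ENNReal.ofReal ((n : ℝ) + 1)⁻¹) ^ 2) atTop := by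
          refine lintegral_congr fun t => ?_
          exact (pow_left_mono (M := ℝ≥0∞) 2).map_liminf_of_continuousAt _
            (ENNReal.continuous_pow 2).continuousAt
      _ ≤ liminf (fun n : ℕ => ∫⁻ t, (edist (ω.extend (t + ((n : ℝ) + 1)⁻¹)) (ω.extend t)
            / ENNReal.ofReal ((n : ℝ) + 1)⁻¹) ^ 2) atTop := by
          refine lintegral_liminf_le fun n => ?_
          have h2 : Continuous fun t => edist (ω.extend (t + ((n : ℝ) + 1)⁻¹)) (ω.extend t) := by
            fun_prop
          exact (h2.measurable.div_const _).pow_const 2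
      _ ≤ 2 * K :=
          liminf_le_of_frequently_le' (Frequently.of_forall fun n => hquot _ (by positivity))
  have hfwd' : ∫⁻ t in Icc (0 : ℝ) 1, forwardSpeed ω.extend t ^ 2 ≤ 2 * K :=
    (lintegral_mono' Measure.restrict_le_self le_rfl).trans hfwd
  have hfin : ∫⁻ t in Icc (0 : ℝ) 1, forwardSpeed ω.extend t ≠ ⊤ := by
    have h1 := sq_lintegral_le (volume.restrict (Icc (0 : ℝ) 1))
      (measurable_forwardSpeed hcω).aemeasurable
    intro htop
    rw [htop, Measure.restrict_apply_univ, Real.volume_Icc] at h1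
    simp only [sub_zero, ENNReal.ofReal_one, one_mul] at h1
    have h2 := h1.trans hfwd'
    rw [ENNReal.top_pow two_ne_zero, top_le_iff] at h2
    exact ENNReal.mul_ne_top (by simp) hK h2
  have hae := ae_metricSpeed_le_forwardSpeed hcω hωac hfin
  rw [kinetic_of_isAC hωac]
  calc 2⁻¹ * ∫⁻ t in Icc (0 : ℝ) 1, metricSpeed ω.extend t ^ 2
      ≤ 2⁻¹ * (2 * K) := by
        gcongr
        refine le_trans ?_ hfwd'
        rw [← restrict_Ioo_eq_restrict_Icc]
        refine lintegral_mono_ae ?_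
        filter_upwards [ae_restrict_of_ae hae, ae_restrict_mem measurableSet_Ioo] with t ht hm
        gcongr
        exact ht hm
    _ = K := by rw [← mul_assoc, ENNReal.inv_mul_cancel (by simp) (by simp), one_mul]


/-! ### The auxiliary topology -/

theorem isBounded_range_of_tendsto_edist {u : ℕ → X} {a : X}
    (hu : Tendsto (fun n => edist (u n) a) atTop (𝓝 0)) : Bornology.IsBounded (range u) :=
  Metric.isBounded_range_of_tendsto u (tendsto_iff_edist_tendsto_0.2 hu)

theorem measurable_of_le_liminf [MeasurableSpace X] [BorelSpace X] {g : X → ℝ≥0∞}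
    (hg : ∀ (u : ℕ → X) (a : X), Tendsto (fun n => edist (u n) a) atTop (𝓝 0) →
      g a ≤ liminf (fun n => g (u n)) atTop) : Measurable g := by
  refine measurable_of_Iic fun c => IsClosed.measurableSet ?_
  refine IsSeqClosed.isClosed fun u a hu ha => ?_
  refine (hg u a (tendsto_iff_edist_tendsto_0.1 ha)).trans ?_
  exact liminf_le_of_frequently_le' (Frequently.of_forall fun n => hu n)

/-- Lower semicontinuity of the Fisher information, for slopes which are lower semicontinuous. -/
theorem fisher_le_liminf {E : X → EReal} {x y : X} {γ : ℕ → Curve x y} {ω : Curve x y}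
    (hE : ∀ (u : ℕ → X) (a : X), Tendsto (fun n => edist (u n) a) atTop (𝓝 0) →
      descSlope E a ≤ liminf (fun n => descSlope E (u n)) atTop)
    (h : ∀ t, descSlope E (ω t) ≤ liminf (fun n => descSlope E (γ n t)) atTop) :
    fisher E ω ≤ liminf (fun n => fisher E (γ n)) atTop := by
  borelize X
  have hm : ∀ n, Measurable fun t => descSlope E ((γ n).extend t) ^ 2 := fun n =>
    ((measurable_of_le_liminf hE).comp (γ n).continuous_extend.measurable).pow_const 2
  have hmono : Monotone fun z : ℝ≥0∞ => 2⁻¹ * z := fun a b hab => by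
    dsimp only
    gcongr
  have hcont : Continuous fun z : ℝ≥0∞ => 2⁻¹ * z := ENNReal.continuous_const_mul (by simp)
  have h1 : ∫⁻ t in Icc (0 : ℝ) 1, descSlope E (ω.extend t) ^ 2
      ≤ liminf (fun n => ∫⁻ t in Icc (0 : ℝ) 1, descSlope E ((γ n).extend t) ^ 2) atTop := by
    refine le_trans (lintegral_mono fun t => ?_) (lintegral_liminf_le hm)
    refine (pow_left_mono (M := ℝ≥0∞) 2 (h (projIcc 0 1 zero_le_one t))).trans_eq ?_
    exact (pow_left_mono (M := ℝ≥0∞) 2).map_liminf_of_continuousAt _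
            (ENNReal.continuous_pow 2).continuousAt
  refine (hmono h1).trans_eq ?_
  exact hmono.map_liminf_of_continuousAt _ hcont.continuousAt

theorem IsAdmissibleTopology.tendsto_of_tendsto_edist {E : X → EReal} {σ : TopologicalSpace X}
    (hσ : IsAdmissibleTopology E σ) {u : ℕ → X} {a : X}
    (hu : Tendsto (fun n => edist (u n) a) atTop (𝓝 0)) :
    Tendsto u atTop (@nhds X σ a) := by
  refine tendsto_of_subseq_tendsto fun ns hns => ?_
  have hv : Tendsto (fun n => edist (u (ns n)) a) atTop (𝓝 0) := hu.comp hns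
  obtain ⟨b, φ, hφ, hb⟩ := hσ.seqCompact _ (isBounded_range_of_tendsto_edist hv)
  refine ⟨φ, ?_⟩
  have h1 := hσ.dist_lsc _ (fun _ => a) b a hb tendsto_const_nhds
  have h2 := h1.trans_eq (hv.comp hφ.tendsto_atTop).liminf_eq
  rw [edist_eq_zero.1 (le_antisymm h2 zero_le)] at hb
  exact hb

/-- Lower semicontinuity of the Fisher information under pointwise convergence. -/
theorem IsAdmissibleTopology.fisher_le_liminf {E : X → EReal} {σ : TopologicalSpace X}
    (hσ : IsAdmissibleTopology E σ) {x y : X} {γ : ℕ → Curve x y} {ω : Curve x y}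
    (h : TendstoPointwise σ (fun n => γ n) ω) :
    fisher E ω ≤ liminf (fun n => fisher E (γ n)) atTop :=
  MetricSchrodinger.fisher_le_liminf
    (fun u a hu => hσ.slope_lsc u a (hσ.tendsto_of_tendsto_edist hu))
    fun t => hσ.slope_lsc _ _ (h t)

theorem edist_le_of_tendsto {E : X → EReal} {σ : TopologicalSpace X}
    (hσ : IsAdmissibleTopology E σ) {x y : X} {γ : ℕ → Curve x y} {K : ℝ≥0∞}
    (hK : K ≠ ⊤) (hγ : ∀ n, kinetic (γ n) ≤ K) {s t : unitInterval} {a b : X} {φ : ℕ → ℕ}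
    (ha : Tendsto (fun n => γ (φ n) s) atTop (@nhds X σ a))
    (hb : Tendsto (fun n => γ (φ n) t) atTop (@nhds X σ b)) :
    edist a b ≤ (edist s t * (2 * K)) ^ (2⁻¹ : ℝ) := by
  refine (hσ.dist_lsc _ _ _ _ ha hb).trans ?_
  refine liminf_le_of_frequently_le' (Frequently.of_forall fun n => ?_)
  rw [ENNReal.le_rpow_inv_iff (by norm_num), show (2 : ℝ) = ((2 : ℕ) : ℝ) by norm_num,
    ENNReal.rpow_natCast]
  refine (edist_sq_le_kinetic
    (isAC_of_kinetic_ne_top ((hγ _).trans_lt hK.lt_top).ne) s t).trans ?_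
  gcongr
  exact hγ _

theorem tendsto_holder_modulus {K : ℝ≥0∞} (hK : K ≠ ⊤) (t : unitInterval) :
    Tendsto (fun s => (edist s t * (2 * K)) ^ (2⁻¹ : ℝ)) (𝓝 t) (𝓝 0) := by
  have h1 : Tendsto (fun s : unitInterval => edist s t) (𝓝 t) (𝓝 0) := by
    have : Continuous fun s : unitInterval => edist s t := by fun_prop
    simpa using this.tendsto t
  have h2 := ENNReal.Tendsto.mul_const (b := 2 * K) h1
    (Or.inr (ENNReal.mul_ne_top (by simp) hK))
  have h3 := (ENNReal.continuous_rpow_const (y := (2⁻¹ : ℝ))).tendsto _ |>.comp h2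
  simpa [Function.comp_def] using h3

theorem exists_curve_of_edist_le {x y : X} {K : ℝ≥0∞} (hK : K ≠ ⊤) {v : unitInterval → X}
    (hv : ∀ s t, edist (v s) (v t) ≤ (edist s t * (2 * K)) ^ (2⁻¹ : ℝ))
    (h0 : v 0 = x) (h1 : v 1 = y) : ∃ ω : Curve x y, ⇑ω = v := by
  have hc : Continuous v := by
    refine continuous_iff_continuousAt.2 fun t => ?_
    refine tendsto_iff_edist_tendsto_0.2 ?_
    exact tendsto_of_tendsto_of_tendsto_of_le_of_le tendsto_const_nhds
      (tendsto_holder_modulus hK t) (fun _ => zero_le) fun s => hv s t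
  exact ⟨⟨⟨v, hc⟩, h0, h1⟩, rfl⟩

theorem Curve.apply_zero {x y : X} (γ : Curve x y) : γ 0 = x := γ.source

theorem Curve.apply_one {x y : X} (γ : Curve x y) : γ 1 = y := γ.target

/-- Pointwise limits of curves of bounded kinetic energy are curves. -/
theorem exists_curve_of_tendstoPointwise {E : X → EReal} {σ : TopologicalSpace X}
    (hσ : IsAdmissibleTopology E σ) {x y : X} {γ : ℕ → Curve x y} {K : ℝ≥0∞}
    (hK : K ≠ ⊤) (hγ : ∀ n, kinetic (γ n) ≤ K) {v : unitInterval → X}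
    (hv : TendstoPointwise σ (fun n => γ n) v) : ∃ ω : Curve x y, ⇑ω = v := by
  have hlim : ∀ (a : X) (t : unitInterval), (∀ n, γ n t = a) → v t = a := by
    intro a t ht
    have h1 := hσ.dist_lsc _ (fun _ => a) _ a (hv t) tendsto_const_nhds
    simpa [ht] using h1
  exact exists_curve_of_edist_le hK
    (fun s t => edist_le_of_tendsto hσ hK hγ (φ := id) (hv s) (hv t))
    (hlim x 0 fun n => Curve.apply_zero (γ n)) (hlim y 1 fun n => Curve.apply_one (γ n))

/-- Lower semicontinuity of the kinetic energy under pointwise convergence. -/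
theorem IsAdmissibleTopology.kinetic_le {E : X → EReal} {σ : TopologicalSpace X}
    (hσ : IsAdmissibleTopology E σ) {x y : X} {γ : ℕ → Curve x y} {ω : Curve x y} {K : ℝ≥0∞}
    (hK : K ≠ ⊤) (hγ : ∀ n, kinetic (γ n) ≤ K) (h : TendstoPointwise σ (fun n => γ n) ω) :
    kinetic ω ≤ K :=
  kinetic_le_of_edist_le_liminf hK hγ fun s t => hσ.dist_lsc _ _ _ _ (h s) (h t)

/-! ### Compactness -/

/-- Diagonal extraction: if countably many properties of sequences of indices are inherited by
subsequences and can each be achieved by passing to a subsequence, then they can be achieved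
simultaneously up to finitely many terms. -/
theorem exists_diagonal_subsequence {P : ℕ → (ℕ → ℕ) → Prop}
    (hex : ∀ k φ, StrictMono φ → ∃ ψ : ℕ → ℕ, StrictMono ψ ∧ P k (φ ∘ ψ))
    (hsub : ∀ k φ (ψ : ℕ → ℕ), P k φ → Tendsto ψ atTop atTop → P k (φ ∘ ψ))
    (htail : ∀ k φ φ', P k φ → φ =ᶠ[atTop] φ' → P k φ') :
    ∃ φ : ℕ → ℕ, StrictMono φ ∧ ∀ k, P k φ := by
  choose! ψ hψ hP using hex
  let Φ : ℕ → ℕ → ℕ := fun k => Nat.rec id (fun k φ => φ ∘ ψ k φ) k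
  have hΦs : ∀ k, Φ (k + 1) = Φ k ∘ ψ k (Φ k) := fun k => rfl
  have hΦ : ∀ k, StrictMono (Φ k) := by
    intro k
    induction k with
    | zero => exact strictMono_id
    | succ k ih => rw [hΦs]; exact ih.comp (hψ k _ ih)
  have hnest : ∀ k j, ∃ θ : ℕ → ℕ, StrictMono θ ∧ Φ (k + j) = Φ k ∘ θ := by
    intro k j
    induction j with
    | zero => exact ⟨id, strictMono_id, rfl⟩
    | succ j ih =>
      obtain ⟨θ, hθ, he⟩ := ih
      refine ⟨θ ∘ ψ (k + j) (Φ (k + j)), hθ.comp (hψ _ _ (hΦ _)), ?_⟩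
      rw [← add_assoc, hΦs, ← Function.comp_assoc, ← he]
  refine ⟨fun n => Φ n n, strictMono_nat_of_lt_succ fun n => ?_, fun k => ?_⟩
  · rw [hΦs]
    exact hΦ n (Nat.lt_of_lt_of_le (Nat.lt_succ_self n) ((hψ n _ (hΦ n)).id_le _))
  · have hk : P k (Φ (k + 1)) := hP k _ (hΦ k)
    choose θ hθ he using hnest (k + 1)
    refine htail k (Φ (k + 1) ∘ fun n => θ (n - (k + 1)) n) _ (hsub k _ _ hk ?_) ?_
    · exact tendsto_atTop_mono (fun n => (hθ _).id_le n) tendsto_id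
    · filter_upwards [eventually_ge_atTop (k + 1)] with n hn
      have := he (n - (k + 1))
      rw [Nat.add_sub_cancel' hn] at this
      rw [Function.comp_apply, this, Function.comp_apply]

/-- Curves with common endpoints and bounded kinetic energy are relatively sequentially compact for
pointwise convergence. -/
theorem IsAdmissibleTopology.exists_tendstoPointwise {E : X → EReal} {σ : TopologicalSpace X}
    (hσ : IsAdmissibleTopology E σ) {x y : X} {γ : ℕ → Curve x y} {K : ℝ≥0∞}
    (hK : K ≠ ⊤) (hγ : ∀ n, kinetic (γ n) ≤ K) :
    ∃ (φ : ℕ → ℕ) (ω : Curve x y), StrictMono φ ∧ TendstoPointwise σ (fun n => γ (φ n)) ω := by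
  have hbdd : ∀ (φ : ℕ → ℕ) (t : unitInterval), Bornology.IsBounded (range fun n => γ (φ n) t) := by
    intro φ t
    have hC : (edist t 0 * (2 * K)) ^ (2⁻¹ : ℝ) ≠ ⊤ :=
      ENNReal.rpow_ne_top_of_nonneg (by norm_num)
        (ENNReal.mul_ne_top (edist_ne_top _ _) (ENNReal.mul_ne_top (by simp) hK))
    refine (Metric.isBounded_closedBall (x := x)
      (r := ((edist t 0 * (2 * K)) ^ (2⁻¹ : ℝ)).toReal)).subset ?_
    rintro _ ⟨n, rfl⟩
    have h := edist_le_of_tendsto (E := E) hσ hK hγ (s := t) (t := 0) (φ := fun _ => φ n)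
      (a := γ (φ n) t) (b := x) tendsto_const_nhds
      (by simpa using (tendsto_const_nhds : Tendsto (fun _ : ℕ => x) atTop (@nhds X σ x)))
    rw [Metric.mem_closedBall, dist_edist]
    exact ENNReal.toReal_mono hC h
  have hd := TopologicalSpace.denseRange_denseSeq unitInterval
  set q := TopologicalSpace.denseSeq unitInterval
  obtain ⟨φ, hφ, hP⟩ := exists_diagonal_subsequence
    (P := fun k φ => ∃ a, Tendsto (fun n => γ (φ n) (q k)) atTop (@nhds X σ a))
    (fun k φ _ => by
      obtain ⟨a, ψ, hψ, h⟩ := hσ.seqCompact _ (hbdd φ (q k))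
      exact ⟨ψ, hψ, a, h⟩)
    (fun k φ ψ ⟨a, h⟩ hψ => ⟨a, h.comp hψ⟩)
    (fun k φ φ' ⟨a, h⟩ he => ⟨a, h.congr' (he.mono fun n hn => by simp only [hn])⟩)
  choose p hp using hP
  have key : ∀ t, ∃ a, Tendsto (fun n => γ (φ n) t) atTop (@nhds X σ a) := by
    intro t
    obtain ⟨a, ψ, hψ, ha⟩ := hσ.seqCompact _ (hbdd φ t)
    refine ⟨a, tendsto_of_subseq_tendsto fun ns hns => ?_⟩
    obtain ⟨b, θ, hθ, hb⟩ := hσ.seqCompact _ (hbdd (fun n => φ (ns n)) t)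
    refine ⟨θ, ?_⟩
    suffices a = b by rw [this]; exact hb
    have hle : ∀ k, edist a b ≤ (edist (q k) t * (2 * K)) ^ (2⁻¹ : ℝ)
        + (edist (q k) t * (2 * K)) ^ (2⁻¹ : ℝ) := by
      intro k
      refine (edist_triangle_left a b (p k)).trans (add_le_add ?_ ?_)
      · exact edist_le_of_tendsto hσ hK hγ (φ := fun n => φ (ψ n))
          ((hp k).comp hψ.tendsto_atTop) ha
      · exact edist_le_of_tendsto hσ hK hγ (φ := fun n => φ (ns (θ n)))
          ((hp k).comp (hns.comp hθ.tendsto_atTop)) hb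
    have hlim : Tendsto (fun s => (edist s t * (2 * K)) ^ (2⁻¹ : ℝ)
        + (edist s t * (2 * K)) ^ (2⁻¹ : ℝ)) (𝓝 t) (𝓝 0) := by
      simpa using (tendsto_holder_modulus hK t).add (tendsto_holder_modulus hK t)
    have hzero : edist a b ≤ 0 := by
      refine ge_of_tendsto_of_frequently hlim ?_
      refine frequently_iff.2 fun {U} hU => ?_
      obtain ⟨_, hs, k, rfl⟩ := mem_closure_iff_nhds.1 (hd t) U hU
      exact ⟨q k, hs, hle k⟩
    exact edist_eq_zero.1 (le_antisymm hzero zero_le)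
  choose v hv using key
  obtain ⟨ω, rfl⟩ := exists_curve_of_tendstoPointwise hσ hK (fun n => hγ (φ n)) hv
  exact ⟨φ, ω, hφ, hv⟩


/-! ### Right derivatives of concave functions -/

section Concave

variable {g : ℝ → ℝ} {C : ℝ}

/-- The right derivative of a concave function, as a supremum of slopes. -/
def supSlope (g : ℝ → ℝ) (s : ℝ) : ℝ := sSup (slope g s '' Ioi s)

theorem slope_le_slope_left (hg : ConcaveOn ℝ (Ici 0) g) {r s t : ℝ} (hr : 0 ≤ r) (hrs : r < s)
    (hst : s < t) : slope g s t ≤ slope g r s := by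
  rw [slope_def_field, slope_def_field]
  exact hg.slope_anti_adjacent hr (hr.trans (hrs.trans hst).le) hrs hst

theorem slope_le_slope_right (hg : ConcaveOn ℝ (Ici 0) g) {r s t : ℝ} (hr : 0 ≤ r) (hrs : r < s)
    (hst : s ≤ t) : slope g r t ≤ slope g r s :=
  hg.slope_anti hr (by simpa [hrs.ne'] using (hr.trans hrs.le))
    (by simpa [(hrs.trans_le hst).ne'] using (hr.trans (hrs.le.trans hst))) hst

variable (hg : ConcaveOn ℝ (Ici 0) g) (hC : ∀ s, 0 ≤ s → g s ≤ g 0 + s * C)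
include hg hC

theorem bddAbove_slope {s : ℝ} (hs : 0 ≤ s) : BddAbove (slope g s '' Ioi s) := by
  have h0 : ∀ t, 0 < t → slope g 0 t ≤ C := by
    intro t ht
    rw [slope_def_field, sub_zero, div_le_iff₀ ht]
    linarith [hC t ht.le]
  refine ⟨C, ?_⟩
  rintro _ ⟨t, ht, rfl⟩
  rcases hs.eq_or_lt with rfl | hs'
  · exact h0 t ht
  · exact (slope_le_slope_left hg le_rfl hs' ht).trans (h0 s hs')

theorem slope_le_supSlope {s t : ℝ} (hs : 0 ≤ s) (hst : s < t) : slope g s t ≤ supSlope g s :=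
  le_csSup (bddAbove_slope hg hC hs) ⟨t, hst, rfl⟩

theorem hasDerivWithinAt_supSlope {s : ℝ} (hs : 0 ≤ s) :
    HasDerivWithinAt g (supSlope g s) (Ici s) s := by
  rw [hasDerivWithinAt_iff_tendsto_slope, Ici_sdiff_left]
  refine tendsto_order.2 ⟨fun l hl => ?_, fun u hu => ?_⟩
  · obtain ⟨_, ⟨t, ht, rfl⟩, hlt⟩ := exists_lt_of_lt_csSup (nonempty_Ioi.image _) hl
    filter_upwards [Ioo_mem_nhdsGT ht] with r hr
    exact hlt.trans_le (slope_le_slope_right hg hs hr.1 hr.2.le)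
  · filter_upwards [self_mem_nhdsWithin] with r hr
    exact (slope_le_supSlope hg hC hs hr).trans_lt hu

theorem continuousWithinAt_supSlope {s : ℝ} (hs : 0 ≤ s) :
    ContinuousWithinAt (supSlope g) (Ici s) s := by
  rw [← continuousWithinAt_Ioi_iff_Ici]
  refine tendsto_order.2 ⟨fun l hl => ?_, fun u hu => ?_⟩
  · obtain ⟨_, ⟨t, ht, rfl⟩, hlt⟩ := exists_lt_of_lt_csSup (nonempty_Ioi.image _) hl
    have hcont : ContinuousWithinAt g (Ioi s) s :=
      (hasDerivWithinAt_supSlope hg hC hs).continuousWithinAt.mono Ioi_subset_Ici_self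
    have hslope : Tendsto (fun r => slope g r t) (𝓝[>] s) (𝓝 (slope g s t)) := by
      simp only [slope_def_field]
      refine Tendsto.div (tendsto_const_nhds.sub hcont) ?_ (sub_pos.2 ht).ne'
      exact tendsto_const_nhds.sub (tendsto_id.mono_left nhdsWithin_le_nhds)
    filter_upwards [hslope.eventually_const_lt hlt, Ioo_mem_nhdsGT ht] with r hr hrt
    exact hr.trans_le (slope_le_supSlope hg hC (hs.trans hrt.1.le) hrt.2)
  · filter_upwards [self_mem_nhdsWithin] with r hr
    refine lt_of_le_of_lt ?_ hu
    refine (csSup_le (nonempty_Ioi.image _) ?_).trans (slope_le_supSlope hg hC hs hr)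
    rintro _ ⟨t, ht, rfl⟩
    exact slope_le_slope_left hg hs hr ht

theorem hasDerivWithinAt_comp_sq {e : ℝ} (he : 0 ≤ e) :
    HasDerivWithinAt (fun e => g (e ^ 2)) (supSlope g (e ^ 2) * (2 * e)) (Ici e) e := by
  have h1 := hasDerivWithinAt_supSlope hg hC (sq_nonneg e)
  have h2 : HasDerivWithinAt (fun e : ℝ => e ^ 2) (2 * e) (Ici e) e := by
    simpa using (hasDerivAt_pow 2 e).hasDerivWithinAt
  exact HasDerivWithinAt.comp (h := fun e : ℝ => e ^ 2) e h1 h2 fun r hr => pow_le_pow_left₀ he hr 2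

theorem continuousWithinAt_derivWithin_comp_sq {e : ℝ} (he : 0 ≤ e) :
    ContinuousWithinAt (fun r => derivWithin (fun e => g (e ^ 2)) (Ici r) r) (Ici e) e := by
  have heq : ∀ r, 0 ≤ r →
      derivWithin (fun e => g (e ^ 2)) (Ici r) r = supSlope g (r ^ 2) * (2 * r) := fun r hr =>
    (hasDerivWithinAt_comp_sq hg hC hr).derivWithin (uniqueDiffWithinAt_Ici r)
  refine ContinuousWithinAt.congr ?_ (fun r hr => heq r (he.trans hr)) (heq e he)
  refine ContinuousWithinAt.mul ?_ (by fun_prop)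
  refine (continuousWithinAt_supSlope hg hC (sq_nonneg e)).comp
    (f := fun r : ℝ => r ^ 2) (by fun_prop) fun r hr => pow_le_pow_left₀ he hr 2

theorem isLittleO_comp_sq :
    (fun e : ℝ => g (e ^ 2) - g 0 - e ^ 2 * supSlope g 0) =o[𝓝[>] 0] fun e : ℝ => e ^ 2 := by
  have h1 := (hasDerivWithinAt_supSlope hg hC le_rfl).isLittleO
  have h2 : Tendsto (fun e : ℝ => e ^ 2) (𝓝[>] 0) (𝓝[≥] 0) := by
    refine tendsto_nhdsWithin_iff.2 ⟨?_, Eventually.of_forall fun e => sq_nonneg e⟩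
    have : Continuous fun e : ℝ => e ^ 2 := by fun_prop
    simpa using (this.tendsto 0).mono_left nhdsWithin_le_nhds
  have h3 := h1.comp_tendsto h2
  simpa [Function.comp_def] using h3

end Concave

/-! ### Lower envelopes of affine functions -/

section Envelope

variable {ι : Type*} {A I : ι → ℝ≥0∞}

/-- The lower envelope of the affine functions `s ↦ A i + s * I i`. -/
def envelope (A I : ι → ℝ≥0∞) (s : ℝ) : ℝ≥0∞ := ⨅ i, A i + ENNReal.ofReal s * I i

theorem envelope_zero (A I : ι → ℝ≥0∞) : envelope A I 0 = ⨅ i, A i := by simp [envelope]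

variable {i₀ : ι} (hA : A i₀ ≠ ⊤) (hI : I i₀ ≠ ⊤)
include hA hI

theorem envelope_ne_top (s : ℝ) : envelope A I s ≠ ⊤ :=
  ne_top_of_le_ne_top (ENNReal.add_ne_top.2 ⟨hA, ENNReal.mul_ne_top ENNReal.ofReal_ne_top hI⟩)
    (iInf_le _ i₀)

theorem concaveOn_envelope : ConcaveOn ℝ (Ici 0) fun s => (envelope A I s).toReal := by
  refine ⟨convex_Ici 0, fun s hs t ht a b ha hb hab => ?_⟩
  have hs' : (0 : ℝ) ≤ s := hs
  have ht' : (0 : ℝ) ≤ t := ht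
  have key : ENNReal.ofReal a * envelope A I s + ENNReal.ofReal b * envelope A I t
      ≤ envelope A I (a * s + b * t) := by
    refine le_iInf fun i => ?_
    calc ENNReal.ofReal a * envelope A I s + ENNReal.ofReal b * envelope A I t
        ≤ ENNReal.ofReal a * (A i + ENNReal.ofReal s * I i)
          + ENNReal.ofReal b * (A i + ENNReal.ofReal t * I i) := by
          gcongr <;> exact iInf_le _ i
      _ = (ENNReal.ofReal a + ENNReal.ofReal b) * A i
          + (ENNReal.ofReal a * ENNReal.ofReal s + ENNReal.ofReal b * ENNReal.ofReal t) * I i := by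
          ring
      _ = A i + ENNReal.ofReal (a * s + b * t) * I i := by
          rw [← ENNReal.ofReal_add ha hb, hab, ENNReal.ofReal_one, one_mul,
            ← ENNReal.ofReal_mul ha, ← ENNReal.ofReal_mul hb,
            ← ENNReal.ofReal_add (by positivity) (by positivity)]
  have h2 := ENNReal.toReal_mono (envelope_ne_top hA hI _) key
  rw [ENNReal.toReal_add (ENNReal.mul_ne_top ENNReal.ofReal_ne_top (envelope_ne_top hA hI _))
    (ENNReal.mul_ne_top ENNReal.ofReal_ne_top (envelope_ne_top hA hI _)), ENNReal.toReal_mul,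
    ENNReal.toReal_mul, ENNReal.toReal_ofReal ha, ENNReal.toReal_ofReal hb] at h2
  simpa using h2

theorem envelope_le_of_minimal (hmin : A i₀ = envelope A I 0) {s : ℝ} (hs : 0 ≤ s) :
    (envelope A I s).toReal ≤ (envelope A I 0).toReal + s * (I i₀).toReal := by
  have h : envelope A I s ≤ A i₀ + ENNReal.ofReal s * I i₀ := iInf_le _ i₀
  have h2 := ENNReal.toReal_mono
    (ENNReal.add_ne_top.2 ⟨hA, ENNReal.mul_ne_top ENNReal.ofReal_ne_top hI⟩) h
  rwa [ENNReal.toReal_add hA (ENNReal.mul_ne_top ENNReal.ofReal_ne_top hI), ENNReal.toReal_mul,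
    ENNReal.toReal_ofReal hs, hmin] at h2

end Envelope


/-! ### Small noise limit -/

/-- The cost as a function of the squared noise parameter. -/
def costSq (E : X → EReal) (x y : X) (s : ℝ) : ℝ≥0∞ :=
  envelope (fun γ : Curve x y => kinetic γ) (fun γ => fisher E γ) s

theorem cost_eq_costSq (E : X → EReal) (x y : X) (ε : ℝ) : cost E x y ε = costSq E x y (ε ^ 2) :=
  rfl

theorem mem_minimizers_zero_iff {E : X → EReal} {x y : X} {ω : Curve x y} :
    ω ∈ minimizers E x y 0 ↔ kinetic ω ≠ ⊤ ∧ kinetic ω = costSq E x y 0 := by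
  simp [minimizers, isAC2_iff_kinetic_ne_top, action, cost_eq_costSq]

theorem costSq_zero_le_kinetic (E : X → EReal) {x y : X} (ω : Curve x y) :
    costSq E x y 0 ≤ kinetic ω := by
  rw [costSq, envelope_zero]
  exact iInf_le _ ω

section

variable {E : X → EReal} {x y : X} {ω₀ : Curve x y} (hω₀ : ω₀ ∈ minimizers E x y 0)
  (hfin : fisher E ω₀ ≠ ⊤)
include hω₀ hfin

theorem costSq_ne_top (s : ℝ) : costSq E x y s ≠ ⊤ :=
  envelope_ne_top (mem_minimizers_zero_iff.1 hω₀).1 hfin s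

theorem concaveOn_costSq : ConcaveOn ℝ (Ici 0) fun s => (costSq E x y s).toReal :=
  concaveOn_envelope (mem_minimizers_zero_iff.1 hω₀).1 hfin

theorem costSq_le (s : ℝ) (hs : 0 ≤ s) :
    (costSq E x y s).toReal ≤ (costSq E x y 0).toReal + s * (fisher E ω₀).toReal :=
  envelope_le_of_minimal (mem_minimizers_zero_iff.1 hω₀).1 hfin
    (mem_minimizers_zero_iff.1 hω₀).2 hs

/-- Almost minimizers of the action have almost minimal kinetic energy, and their Fisher information
is controlled by the right derivative of the cost at zero. -/
theorem kinetic_fisher_le_of_almost_minimal {γ : Curve x y} {s δ : ℝ} (hs : 0 < s) (hδ : 0 ≤ δ)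
    (h : kinetic γ + ENNReal.ofReal s * fisher E γ ≤ costSq E x y s + ENNReal.ofReal (s * δ)) :
    kinetic γ ≤ ENNReal.ofReal ((costSq E x y 0).toReal
        + s * (supSlope (fun s => (costSq E x y s).toReal) 0 + δ)) ∧
      fisher E γ ≤ ENNReal.ofReal (supSlope (fun s => (costSq E x y s).toReal) 0 + δ) := by
  set D := supSlope (fun s => (costSq E x y s).toReal) 0 with hD
  have hslope := slope_le_supSlope (concaveOn_costSq hω₀ hfin) (costSq_le hω₀ hfin) le_rfl hs
  rw [slope_def_field, sub_zero, div_le_iff₀ hs, ← hD] at hslope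
  have htop : costSq E x y s + ENNReal.ofReal (s * δ) ≠ ⊤ :=
    ENNReal.add_ne_top.2 ⟨costSq_ne_top hω₀ hfin s, ENNReal.ofReal_ne_top⟩
  have hl := ENNReal.add_ne_top.1 (ne_top_of_le_ne_top htop h)
  have hIfin : fisher E γ ≠ ⊤ := fun hI => hl.2 (by rw [hI, ENNReal.mul_top (by simpa using hs)])
  have hr := ENNReal.toReal_mono htop h
  rw [ENNReal.toReal_add hl.1 hl.2, ENNReal.toReal_mul, ENNReal.toReal_ofReal hs.le,
    ENNReal.toReal_add (costSq_ne_top hω₀ hfin s) ENNReal.ofReal_ne_top,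
    ENNReal.toReal_ofReal (by positivity)] at hr
  have hA := ENNReal.toReal_mono hl.1 (costSq_zero_le_kinetic E γ)
  have hI0 : 0 ≤ s * (fisher E γ).toReal := by positivity
  constructor
  · refine ENNReal.le_ofReal_iff_toReal_le hl.1 ?_ |>.2 ?_
    all_goals nlinarith [ENNReal.toReal_nonneg (a := kinetic γ)]
  · have hle : (fisher E γ).toReal ≤ D + δ := by
      refine le_of_mul_le_mul_left ?_ hs
      nlinarith
    exact (ENNReal.le_ofReal_iff_toReal_le hIfin (ENNReal.toReal_nonneg.trans hle)).2 hle

end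

/-- The right derivative of the cost at zero is bounded by the Fisher information of geodesics. -/
theorem ofReal_supSlope_le_fisher {E : X → EReal} {x y : X} {ω : Curve x y}
    (hω : ω ∈ minimizers E x y 0) :
    ENNReal.ofReal (supSlope (fun s => (costSq E x y s).toReal) 0) ≤ fisher E ω := by
  by_cases hI : fisher E ω = ⊤
  · rw [hI]; exact le_top
  refine ENNReal.ofReal_le_of_le_toReal (csSup_le (nonempty_Ioi.image _) ?_)
  rintro _ ⟨t, ht, rfl⟩
  have ht' : (0 : ℝ) < t := ht
  rw [slope_def_field, sub_zero, div_le_iff₀ ht']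
  linarith [costSq_le hω hI t ht'.le]

/-- The kinetic energies of almost minimizers are eventually below each number above the minimal
kinetic energy. -/
theorem eventually_kinetic_le_of_almost_minimal {E : X → EReal} {x y : X} {ω₀ : Curve x y}
    (hω₀ : ω₀ ∈ minimizers E x y 0) (hfin : fisher E ω₀ ≠ ⊤) {γ : ℕ → Curve x y} {s δ : ℕ → ℝ}
    (hs : ∀ n, 0 < s n) (hδ : ∀ n, 0 ≤ δ n) (hs0 : Tendsto s atTop (𝓝 0))
    (hδ0 : Tendsto δ atTop (𝓝 0))
    (h : ∀ n, kinetic (γ n) + ENNReal.ofReal (s n) * fisher E (γ n)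
      ≤ costSq E x y (s n) + ENNReal.ofReal (s n * δ n))
    {K : ℝ≥0∞} (hK : costSq E x y 0 < K) : ∀ᶠ n in atTop, kinetic (γ n) ≤ K := by
  have h1 : Tendsto (fun n => ENNReal.ofReal ((costSq E x y 0).toReal
      + s n * (supSlope (fun s => (costSq E x y s).toReal) 0 + δ n))) atTop
      (𝓝 (costSq E x y 0)) := by
    have h2 := ENNReal.tendsto_ofReal ((hs0.mul
      (hδ0.const_add (supSlope (fun s => (costSq E x y s).toReal) 0))).const_add
      (costSq E x y 0).toReal)
    simpa [ENNReal.ofReal_toReal (costSq_ne_top hω₀ hfin 0)] using h2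
  filter_upwards [h1.eventually_lt_const hK] with n hn
  exact (kinetic_fisher_le_of_almost_minimal hω₀ hfin (hs n) (hδ n) (h n)).1.trans hn.le

theorem TendstoPointwise.comp {Y : Type*} {σ : TopologicalSpace Y} {u : ℕ → unitInterval → Y}
    {v : unitInterval → Y} (h : TendstoPointwise σ u v) {φ : ℕ → ℕ}
    (hφ : Tendsto φ atTop atTop) : TendstoPointwise σ (fun n => u (φ n)) v :=
  fun t => (h t).comp hφ

/-- Pointwise limits of almost minimizers are geodesics of minimal Fisher information. -/
theorem fisherMinimal_of_tendstoPointwise {E : X → EReal} {σ : TopologicalSpace X}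
    (hσ : IsAdmissibleTopology E σ) {x y : X} {ω₀ : Curve x y}
    (hω₀ : ω₀ ∈ minimizers E x y 0) (hfin : fisher E ω₀ ≠ ⊤) {γ : ℕ → Curve x y} {s δ : ℕ → ℝ}
    (hs : ∀ n, 0 < s n) (hδ : ∀ n, 0 ≤ δ n) (hs0 : Tendsto s atTop (𝓝 0))
    (hδ0 : Tendsto δ atTop (𝓝 0))
    (h : ∀ n, kinetic (γ n) + ENNReal.ofReal (s n) * fisher E (γ n)
      ≤ costSq E x y (s n) + ENNReal.ofReal (s n * δ n))
    {v : unitInterval → X} (hv : TendstoPointwise σ (fun n => γ n) v) :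
    ∃ ω : Curve x y, ⇑ω = v ∧ ω ∈ minimizers E x y 0 ∧
      fisher E ω ≤ ENNReal.ofReal (supSlope (fun s => (costSq E x y s).toReal) 0) := by
  have hG := costSq_ne_top hω₀ hfin 0
  have hev : ∀ K, costSq E x y 0 < K → ∃ N, ∀ n, kinetic (γ (n + N)) ≤ K := by
    intro K hK
    obtain ⟨N, hN⟩ := eventually_atTop.1
      (eventually_kinetic_le_of_almost_minimal hω₀ hfin hs hδ hs0 hδ0 h hK)
    exact ⟨N, fun n => hN _ (Nat.le_add_left _ _)⟩
  obtain ⟨N, hN⟩ := hev (costSq E x y 0 + 1) (ENNReal.lt_add_right hG one_ne_zero)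
  obtain ⟨ω, rfl⟩ := exists_curve_of_tendstoPointwise hσ
    (ENNReal.add_ne_top.2 ⟨hG, ENNReal.one_ne_top⟩) hN (hv.comp (tendsto_add_atTop_nat N))
  have hkin : kinetic ω ≤ costSq E x y 0 := by
    refine le_of_forall_gt_imp_ge_of_dense fun K hK => ?_
    by_cases hKt : K = ⊤
    · rw [hKt]; exact le_top
    obtain ⟨M, hM⟩ := hev K hK
    exact hσ.kinetic_le hKt hM (hv.comp (tendsto_add_atTop_nat M))
  refine ⟨ω, rfl, mem_minimizers_zero_iff.2 ⟨ne_top_of_le_ne_top hG hkin,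
    le_antisymm hkin (costSq_zero_le_kinetic E ω)⟩, ?_⟩
  have hlim : Tendsto (fun n => ENNReal.ofReal
      (supSlope (fun s => (costSq E x y s).toReal) 0 + δ n)) atTop
      (𝓝 (ENNReal.ofReal (supSlope (fun s => (costSq E x y s).toReal) 0))) := by
    simpa using ENNReal.tendsto_ofReal
      (hδ0.const_add (supSlope (fun s => (costSq E x y s).toReal) 0))
  rw [← hlim.liminf_eq]
  exact (hσ.fisher_le_liminf hv).trans (liminf_le_liminf (Eventually.of_forall fun n =>
    (kinetic_fisher_le_of_almost_minimal hω₀ hfin (hs n) (hδ n) (h n)).2))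

theorem exists_tendstoPointwise_of_almost_minimal {E : X → EReal} {σ : TopologicalSpace X}
    (hσ : IsAdmissibleTopology E σ) {x y : X} {ω₀ : Curve x y}
    (hω₀ : ω₀ ∈ minimizers E x y 0) (hfin : fisher E ω₀ ≠ ⊤) {γ : ℕ → Curve x y} {s δ : ℕ → ℝ}
    (hs : ∀ n, 0 < s n) (hδ : ∀ n, 0 ≤ δ n) (hs0 : Tendsto s atTop (𝓝 0))
    (hδ0 : Tendsto δ atTop (𝓝 0))
    (h : ∀ n, kinetic (γ n) + ENNReal.ofReal (s n) * fisher E (γ n)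
      ≤ costSq E x y (s n) + ENNReal.ofReal (s n * δ n)) :
    ∃ (φ : ℕ → ℕ) (ω : Curve x y), StrictMono φ ∧ TendstoPointwise σ (fun n => γ (φ n)) ω ∧
      ω ∈ minimizers E x y 0 ∧
      fisher E ω ≤ ENNReal.ofReal (supSlope (fun s => (costSq E x y s).toReal) 0) := by
  have hG := costSq_ne_top hω₀ hfin 0
  obtain ⟨N, hN⟩ := eventually_atTop.1 (eventually_kinetic_le_of_almost_minimal hω₀ hfin hs hδ hs0
    hδ0 h (ENNReal.lt_add_right hG one_ne_zero))
  obtain ⟨φ, ω, hφ, hω⟩ := hσ.exists_tendstoPointwise (γ := fun n => γ (n + N))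
    (ENNReal.add_ne_top.2 ⟨hG, ENNReal.one_ne_top⟩) fun n => hN _ (Nat.le_add_left _ _)
  have hψ : StrictMono fun n => φ n + N := fun m n hmn => Nat.add_lt_add_right (hφ hmn) N
  obtain ⟨ω', hω', hmem⟩ := fisherMinimal_of_tendstoPointwise hσ hω₀ hfin
    (fun n => hs (φ n + N)) (fun n => hδ (φ n + N)) (hs0.comp hψ.tendsto_atTop)
    (hδ0.comp hψ.tendsto_atTop) (fun n => h (φ n + N)) hω
  exact ⟨fun n => φ n + N, ω', hψ, by rw [hω']; exact hω, hmem⟩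

/-- The right derivative of the cost at zero is the least Fisher information of a geodesic. -/
theorem iInf_fisher_eq_ofReal_supSlope {E : X → EReal} {σ : TopologicalSpace X}
    (hσ : IsAdmissibleTopology E σ) {x y : X} {ω₀ : Curve x y}
    (hω₀ : ω₀ ∈ minimizers E x y 0) (hfin : fisher E ω₀ ≠ ⊤) :
    ⨅ ω ∈ minimizers E x y 0, fisher E ω
      = ENNReal.ofReal (supSlope (fun s => (costSq E x y s).toReal) 0) := by
  refine le_antisymm ?_ (le_iInf₂ fun ω hω => ofReal_supSlope_le_fisher hω)
  let s : ℕ → ℝ := fun n => 1 / ((n : ℝ) + 1)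
  have hs : ∀ n, 0 < s n := fun n => by positivity
  have hs0 : Tendsto s atTop (𝓝 0) := tendsto_one_div_add_atTop_nhds_zero_nat
  have hex : ∀ n, ∃ γ : Curve x y, kinetic γ + ENNReal.ofReal (s n) * fisher E γ
      < costSq E x y (s n) + ENNReal.ofReal (s n * s n) := fun n =>
    iInf_lt_iff.1 (ENNReal.lt_add_right (costSq_ne_top hω₀ hfin (s n))
      (by simpa using mul_pos (hs n) (hs n)))
  choose γ hγ using hex
  obtain ⟨_, ω, _, _, hω, hle⟩ := exists_tendstoPointwise_of_almost_minimal hσ hω₀ hfin hs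
    (fun n => (hs n).le) hs0 hs0 fun n => (hγ n).le
  exact (iInf₂_le ω hω).trans hle

end MetricSchrodinger

end

open MetricSchrodinger in
theorem theorem5p6 {X : Type*} [MetricSpace X] [CompleteSpace X]
    [TopologicalSpace.SeparableSpace X]
    (E : X → EReal) (hE : IsEVIFunctional E)
    (σ : TopologicalSpace X) (hσ : IsAdmissibleTopology E σ)
    (x y : X)
    (hsolv : ∃ ε : ℝ, 0 < ε ∧ (minimizers E x y ε).Nonempty)
    (hfin : ∃ ω₀ ∈ minimizers E x y 0, fisher E ω₀ < ⊤) :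
    -- the cost is finite, so it may be regarded as a real function of `ε ≥ 0`
    (∀ ε : ℝ, 0 ≤ ε → cost E x y ε < ⊤) ∧
    -- it is right differentiable at `0` with right derivative `0`
    HasDerivWithinAt (fun ε => (cost E x y ε).toReal) 0 (Ici 0) 0 ∧
    -- the right derivative exists and is right continuous at every `ε ≥ 0`
    (∀ ε : ℝ, 0 ≤ ε →
      DifferentiableWithinAt ℝ (fun s => (cost E x y s).toReal) (Ici ε) ε ∧
      ContinuousWithinAt
        (fun r => derivWithin (fun s => (cost E x y s).toReal) (Ici r) r) (Ici ε) ε) ∧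
    -- second order expansion
    ((fun ε : ℝ => (cost E x y ε).toReal - (cost E x y 0).toReal
        - ε ^ 2 * (⨅ ω ∈ minimizers E x y 0, fisher E ω).toReal)
      =o[𝓝[>] 0] fun ε : ℝ => ε ^ 2) ∧
    -- sequences of minimizers
    (∀ (ε : ℕ → ℝ) (ω : ℕ → Curve x y), (∀ n, 0 < ε n) → Tendsto ε atTop (𝓝 0) →
      (∀ n, ω n ∈ minimizers E x y (ε n)) →
        (∃ (φ : ℕ → ℕ) (ω' : Curve x y), StrictMono φ ∧
          TendstoPointwise σ (fun n => ω (φ n)) ω' ∧ IsFisherMinimalGeodesic E ω') ∧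
        (∀ (φ : ℕ → ℕ) (v : unitInterval → X), StrictMono φ →
          TendstoPointwise σ (fun n => ω (φ n)) v →
            ∃ ω' : Curve x y, ⇑ω' = v ∧ IsFisherMinimalGeodesic E ω')) := by
  obtain ⟨ω₀, hω₀, hfin'⟩ := hfin
  have hI := hfin'.ne
  have hg := concaveOn_costSq hω₀ hI
  have hC := costSq_le hω₀ hI
  have hinf := iInf_fisher_eq_ofReal_supSlope hσ hω₀ hI
  have hD0 : 0 ≤ supSlope (fun s => (costSq E x y s).toReal) 0 := by
    refine le_trans ?_ (slope_le_supSlope hg hC le_rfl one_pos)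
    rw [slope_def_field]
    refine div_nonneg (sub_nonneg.2 (ENNReal.toReal_mono (costSq_ne_top hω₀ hI 1) ?_)) (by simp)
    refine le_iInf fun γ => (costSq_zero_le_kinetic E γ).trans le_self_add
  have hzero : cost E x y 0 = costSq E x y 0 := by simp [cost_eq_costSq]
  refine ⟨fun ε _ => (costSq_ne_top hω₀ hI _).lt_top, ?_, fun ε hε => ⟨?_, ?_⟩, ?_, ?_⟩
  · simpa [cost_eq_costSq] using hasDerivWithinAt_comp_sq hg hC le_rfl
  · exact (hasDerivWithinAt_comp_sq hg hC hε).differentiableWithinAt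
  · exact continuousWithinAt_derivWithin_comp_sq hg hC hε
  · rw [hinf, ENNReal.toReal_ofReal hD0, hzero]
    exact isLittleO_comp_sq hg hC
  · intro ε ω hε hε0 hω
    have hs : ∀ n, 0 < ε n ^ 2 := fun n => pow_pos (hε n) 2
    have hs0 : Tendsto (fun n => ε n ^ 2) atTop (𝓝 0) := by simpa using hε0.pow 2
    have hmin : ∀ n, kinetic (ω n) + ENNReal.ofReal (ε n ^ 2) * fisher E (ω n)
        ≤ costSq E x y (ε n ^ 2) + ENNReal.ofReal (ε n ^ 2 * 0) := fun n =>
      (hω n).2.le.trans le_self_add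
    have hfm : ∀ ω' ∈ minimizers E x y 0,
        fisher E ω' ≤ ENNReal.ofReal (supSlope (fun s => (costSq E x y s).toReal) 0) →
        IsFisherMinimalGeodesic E ω' := fun ω' h1 h2 =>
      ⟨h1, fun ω'' h'' => h2.trans (ofReal_supSlope_le_fisher h'')⟩
    constructor
    · obtain ⟨φ, ω', hφ, hlim, h1, h2⟩ := exists_tendstoPointwise_of_almost_minimal hσ hω₀ hI hs
        (fun _ => le_rfl) hs0 tendsto_const_nhds hmin
      exact ⟨φ, ω', hφ, hlim, hfm ω' h1 h2⟩
    · intro φ v hφ hv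
      obtain ⟨ω', he, h1, h2⟩ := fisherMinimal_of_tendstoPointwise hσ hω₀ hI
        (fun n => hs (φ n)) (fun _ => le_rfl) (hs0.comp hφ.tendsto_atTop) tendsto_const_nhds
        (fun n => hmin (φ n)) hv
      exact ⟨ω', he, hfm ω' h1 h2⟩
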